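/- Let $n\ge 2$, let $\mathcal A=\{A_1,\dots,A_n\}$ be a set of quantum systems with finite-dimensional complex Hilbert spaces $\mathcal H_{A_i}$, let $\rho$ be a density operator (positive semidefinite, $\operatorname{Tr}\rho=1$) on $\mathcal H_{A_1}\otimes\cdots\otimes\mathcal H_{A_n}$, and let $q>1$. For $J\subseteq\mathcal A$ let $\rho_J$ be the marginal of $\rho$ on $J$ (the partial trace over the systems outside $J$), and put $$S_q(J)_\rho=\frac{1}{1-q}\bigl(\operatorname{Tr}\rho_J^{\,q}-1\bigr),\qquad C_q(J)_\rho=\sum_{v\in J}S_q(\{v\})_\rho-S_q(J)_\rho ,$$ so that $S_q(\varnothing)_\rho=0$. Let $K$ be a field. Then $C_q(I)_\rho\le C_q(J)_\rho$ for all $\varnothing\ne I\subseteq J\subseteq\mathcal A$, so that the sets $$G(\varepsilon)=\{J\subseteq\mathcal A : J\neq\varnothing,\ C_q(J)_\rho\le\varepsilon\},\qquad \varepsilon\in\mathbb R,$$ form a filtration by abstract simplicial complexes. Let $\widetilde\beta_k(\varepsilon)=\dim_K\widetilde H_k(G(\varepsilon);K)$, $k\ge 0$, be the reduced Betti numbers,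 that is, the dimensions of the homology groups of the augmented simplicial chain complex, and let $$\widetilde{\mathfrak X}_q(\varepsilon)=\sum_{k=0}^{\infty}(-1)^k\int_0^{\varepsilon}\widetilde\beta_k(t)\,dt$$ be the reduced integrated Euler characteristic. Each $\widetilde\beta_k$ is integrable on $(0,\infty)$, the series converges for every $\varepsilon$, and $\widetilde{\mathfrak X}_q(\infty):=\lim_{\varepsilon\to\infty}\widetilde{\mathfrak X}_q(\varepsilon)$ exists and equals the $q$-deformed interaction information: $$\widetilde{\mathfrak X}_q(\infty)=\sum_{J\subseteq\mathcal A}(-1)^{|J|-1}S_q(J)_\rho=I_q(\mathcal A)_\rho .$$ -/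

import Mathlib

open scoped ComplexOrder

noncomputable section

/-! ### Quantum states, marginals and entropies

A system of parties is a finite index type `ι`; party `i` has Hilbert space `ℂ^(d i)` for a finite
index type `d i`, so that the joint Hilbert space is `ℂ^(Π i, d i)`, and operators are written as
matrices in the product basis. -/

/-- Density operators: positive semidefinite with unit trace. -/
structure IsDensityOperator {a : Type*} [Fintype a] (ρ : Matrix a a ℂ) : Prop where
  posSemidef : ρ.PosSemidef
  trace_eq_one : ρ.trace = 1

/-- The marginal `ρ_J`: the partial trace of `ρ` over all parties outside `J`. -/
def marginal {ι : Type*} [Fintype ι] [DecidableEq ι] {d : ι → Type*} [∀ i, Fintype (d i)]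
    (ρ : Matrix (∀ i, d i) (∀ i, d i) ℂ) (J : Finset ι) :
    Matrix (∀ i : {i // i ∈ J}, d i) (∀ i : {i // i ∈ J}, d i) ℂ :=
  fun x y => ∑ z : (∀ i : {i // i ∉ J}, d i),
    ρ ((Equiv.piEquivPiSubtypeProd (fun i => i ∈ J) d).symm (x, z))
      ((Equiv.piEquivPiSubtypeProd (fun i => i ∈ J) d).symm (y, z))

/-- The Tsallis entropy `S_q(σ) = (Tr σ^q - 1) / (1 - q)`; the power `σ^q` is taken in the
functional calculus of the Hermitian matrix `σ`. -/
def tsallisEntropy {a : Type*} [Fintype a] [DecidableEq a] (q : ℝ) (σ : Matrix a a ℂ) : ℝ :=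
  1 / (1 - q) * ((cfc (fun x : ℝ => x ^ q) σ).trace.re - 1)

/-- `S_q(J)_ρ`, the Tsallis entropy of the marginal on `J`. For `J = ∅` the marginal is the
`1 × 1` matrix with entry `Tr ρ`, so this is `0` for a density operator. -/
def subsystemEntropy {ι : Type*} [Fintype ι] [DecidableEq ι] {d : ι → Type*} [∀ i, Fintype (d i)]
    [∀ i, DecidableEq (d i)] (q : ℝ) (ρ : Matrix (∀ i, d i) (∀ i, d i) ℂ) (J : Finset ι) : ℝ :=
  tsallisEntropy q (marginal ρ J)

/-- The `q`-deformed total correlation `C_q(J)_ρ`. -/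
def totalCorrelation {ι : Type*} [Fintype ι] [DecidableEq ι] {d : ι → Type*} [∀ i, Fintype (d i)]
    [∀ i, DecidableEq (d i)] (q : ℝ) (ρ : Matrix (∀ i, d i) (∀ i, d i) ℂ) (J : Finset ι) : ℝ :=
  ∑ v ∈ J, subsystemEntropy q ρ {v} - subsystemEntropy q ρ J

/-- The `q`-deformed interaction information `I_q(𝒜)_ρ` of the set `𝒜` of all parties. -/
def interactionInformation {ι : Type*} [Fintype ι] [DecidableEq ι] {d : ι → Type*}
    [∀ i, Fintype (d i)] [∀ i, DecidableEq (d i)] (q : ℝ)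
    (ρ : Matrix (∀ i, d i) (∀ i, d i) ℂ) : ℝ :=
  ∑ J : Finset ι, (-1 : ℝ) ^ ((J.card : ℤ) - 1) * subsystemEntropy q ρ J

/-! ### Reduced simplicial homology over a field -/

/-- The boundary operator on formal `K`-linear combinations `∑ c J • J` of sets of vertices,
`∂ (v₀ < ⋯ < v_k) = ∑ i, (-1)^i (v₀, …, v̂_i, …, v_k)`. A vertex `{v}` is sent to the empty
simplex, which is the augmentation. -/
def simplicialBoundary (K : Type*) [Field K] (ι : Type*) [Fintype ι] [LinearOrder ι] :
    (Finset ι → K) →ₗ[K] (Finset ι → K) :=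
  Fintype.linearCombination K fun J : Finset ι =>
    ∑ v ∈ J, Pi.single (J.erase v) ((-1 : K) ^ (J.filter (· < v)).card)

/-- The augmented chain group spanned by the simplices of `G` with exactly `m` vertices; the
simplicial dimension is `m - 1`. The empty simplex is always present and spans the copy of `K`
in dimension `-1`. -/
def augmentedChains (K : Type*) [Field K] {ι : Type*}
    (G : PreAbstractSimplicialComplex ι) (m : ℕ) : Submodule K (Finset ι → K) where
  carrier := {c | ∀ J : Finset ι, c J ≠ 0 → (J = ∅ ∨ J ∈ G.faces) ∧ J.card = m}
  zero_mem' := fun _ h => absurd rfl h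
  add_mem' := fun {a b} ha hb J h => by
    by_cases h0 : a J = 0
    · exact hb J fun h1 => h (by simp [h0, h1])
    · exact ha J h0
  smul_mem' := fun r a ha J h => ha J fun h0 => h (by simp [h0])

/-- The `k`-cycles of the augmented chain complex of `G`. -/
def reducedCycles (K : Type*) [Field K] {ι : Type*} [Fintype ι] [LinearOrder ι]
    (G : PreAbstractSimplicialComplex ι) (k : ℕ) : Submodule K (Finset ι → K) :=
  augmentedChains K G (k + 1) ⊓ LinearMap.ker (simplicialBoundary K ι)

/-- The `k`-boundaries of `G`: the image of the `(k + 1)`-chains. -/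
def reducedBoundaries (K : Type*) [Field K] {ι : Type*} [Fintype ι] [LinearOrder ι]
    (G : PreAbstractSimplicialComplex ι) (k : ℕ) : Submodule K (Finset ι → K) :=
  (augmentedChains K G (k + 2)).map (simplicialBoundary K ι)

/-- The reduced homology of `G` in dimension `k`, cycles modulo boundaries. -/
abbrev ReducedHomology (K : Type*) [Field K] {ι : Type*} [Fintype ι] [LinearOrder ι]
    (G : PreAbstractSimplicialComplex ι) (k : ℕ) : Type _ :=
  reducedCycles K G k ⧸ (reducedBoundaries K G k).submoduleOf (reducedCycles K G k)

/-! ### The persistence complex of a monotone functional and its summaries -/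

/-- Monotonicity of a functional on the nonempty subsets (its value at `∅` plays no role). -/
def IsMonotoneFunctional {ι : Type*} (F : Finset ι → ℝ) : Prop :=
  ∀ I J : Finset ι, I.Nonempty → I ⊆ J → F I ≤ F J

/-- The sublevel complex `G(ε) = {J ≠ ∅ : F J ≤ ε}` of a monotone functional `F`. -/
def sublevelComplex {ι : Type*} (F : Finset ι → ℝ) (hF : IsMonotoneFunctional F) (ε : ℝ) :
    PreAbstractSimplicialComplex ι where
  faces := {J | J.Nonempty ∧ F J ≤ ε}
  isRelLowerSet_faces := fun J hJ =>
    ⟨hJ.1, fun I hIJ hI => ⟨hI, (hF I J hI hIJ).trans hJ.2⟩⟩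

/-- The reduced Betti number of `G(ε)` in dimension `k`. -/
def reducedBetti (K : Type*) [Field K] {ι : Type*} [Fintype ι] [LinearOrder ι]
    (F : Finset ι → ℝ) (hF : IsMonotoneFunctional F) (k : ℕ) (ε : ℝ) : ℕ :=
  Module.finrank K (ReducedHomology K (sublevelComplex F hF ε) k)

/-- The reduced integrated Betti number, `∫₀^ε` of the reduced Betti number. -/
def reducedIntegratedBetti (K : Type*) [Field K] {ι : Type*} [Fintype ι] [LinearOrder ι]
    (F : Finset ι → ℝ) (hF : IsMonotoneFunctional F) (k : ℕ) (ε : ℝ) : ℝ :=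
  ∫ t in (0 : ℝ)..ε, (reducedBetti K F hF k t : ℝ)

/-- The reduced integrated Euler characteristic up to filtration value `ε`. -/
def reducedIntegratedEulerChar (K : Type*) [Field K] {ι : Type*} [Fintype ι] [LinearOrder ι]
    (F : Finset ι → ℝ) (hF : IsMonotoneFunctional F) (ε : ℝ) : ℝ :=
  ∑' k : ℕ, (-1 : ℝ) ^ k * reducedIntegratedBetti K F hF k ε

end

/-! Two independent facts combine: monotonicity of `C_q`, which makes the filtration exist, and an
Euler characteristic count, which evaluates the integral.

Monotonicity is subadditivity of `S_q` for `q > 1`, applied one party at a time. Classically, let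
`l`, `m` be the marginals of `p`, and `x`, `y` their dual vectors, with entries in `[0, 1]` and unit
`ℓ^r` norm. Averaging `(1 - x)(1 - y) ≥ 0` against `p` and using Hölder gives `‖l‖_q + ‖m‖_q ≤ 1 +
‖p‖_q`; convexity of the power passes this to `q`-th powers (`sum_rpow_marginals_le`). For a quantum
state, take as `p` its diagonal in the product of the eigenbases of the two marginals: the marginals
of `p` are then the two spectra, and Peierls' inequality bounds `∑ p ^ q` by `Tr ρ ^ q`
(`tsallisEntropy_le_add`).

For `t ≥ 0` all vertices are present, because `C_q` vanishes on singletons. Euler–Poincaré and `∑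
(-1)^|J| = 0` turn the alternating sum of Betti numbers at `t` into the sum of `(-1)^|J|` over the
sets with `C_q(J) > t`. Integrated over `t`, each `J` contributes `(-1)^|J| C_q(J)`. In the total
the one-party entropies cancel as `n ≥ 2`, leaving the interaction information. Beyond `C_q(𝒜)` the
complex is a full simplex, hence acyclic, which gives integrability on the half-line. -/

/-! ### Subadditivity of the classical Tsallis entropy -/

/-- Convexity of `x ↦ x ^ q`: an inequality `x + y ≤ 1 + z` in the unit interval passes to
`q`-th powers. -/
theorem rpow_add_rpow_le_one_add_rpow {q x y z : ℝ} (hq : 1 < q) (hx0 : 0 ≤ x) (hx1 : x ≤ 1)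
    (hy0 : 0 ≤ y) (hy1 : y ≤ 1) (hz : 0 ≤ z) (h : x + y ≤ 1 + z) :
    x ^ q + y ^ q ≤ 1 + z ^ q := by
  have hle : ∀ t : ℝ, 0 ≤ t → t ≤ 1 → t ^ q ≤ t := fun t h0 h1 => by
    simpa using Real.rpow_le_rpow_of_exponent_ge' h0 h1 zero_le_one hq.le
  rcases le_total (x + y) 1 with hxy | hxy
  · linarith [hle x hx0 hx1, hle y hy0 hy1, Real.rpow_nonneg hz q]
  -- `w` is the least value allowed for `z`, so it suffices to bound by `1 + w ^ q`.
  · obtain ⟨w, hw⟩ : ∃ w, w = x + y - 1 := ⟨_, rfl⟩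
    have hw0 : 0 ≤ w := by linarith
    have hwz : w ^ q ≤ z ^ q := Real.rpow_le_rpow hw0 (by linarith) (by linarith)
    rcases eq_or_lt_of_le (show w ≤ 1 by linarith) with hw1 | hw1
    · have hx : x = 1 := by linarith
      have hy : y = 1 := by linarith
      subst hx hy
      rw [hw1, Real.one_rpow] at hwz
      rw [Real.one_rpow]
      linarith
    · have hpos : 0 < 1 - w := by linarith
      -- `x` and `y` are convex combinations of `w` and `1` with interchanged weights; the two
      -- convexity inequalities add up to the claim.
      have hθ0 : 0 ≤ (1 - x) / (1 - w) := div_nonneg (by linarith) hpos.le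
      have hθ1 : 0 ≤ (1 - y) / (1 - w) := div_nonneg (by linarith) hpos.le
      have hsum : (1 - x) / (1 - w) + (1 - y) / (1 - w) = 1 := by
        rw [← add_div, div_eq_one_iff_eq hpos.ne']; linarith
      have hconv := convexOn_rpow hq.le
      have h1 := hconv.2 (Set.mem_Ici.2 hw0) (Set.mem_Ici.2 zero_le_one) hθ0 hθ1 hsum
      have h2 := hconv.2 (Set.mem_Ici.2 hw0) (Set.mem_Ici.2 zero_le_one) hθ1 hθ0
        (by rw [add_comm]; exact hsum)
      have e1 : (1 - x) / (1 - w) * w + (1 - y) / (1 - w) * 1 = x := by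
        field_simp; rw [hw]; ring
      have e2 : (1 - y) / (1 - w) * w + (1 - x) / (1 - w) * 1 = y := by
        field_simp; rw [hw]; ring
      simp only [smul_eq_mul, Real.one_rpow] at h1 h2
      rw [e1] at h1
      rw [e2] at h2
      have h3 : ((1 - x) / (1 - w) + (1 - y) / (1 - w)) * (w ^ q + 1) = w ^ q + 1 := by
        rw [hsum, one_mul]
      linarith

/-- A vector attaining the `ℓ^q` norm of a probability vector in the duality with `ℓ^r`. -/
theorem exists_holder_dual_vector {α : Type*} [Fintype α] {q r : ℝ} (hqr : q.HolderConjugate r)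
    (l : α → ℝ) (h0 : ∀ i, 0 ≤ l i) (h1 : ∑ i, l i = 1) :
    ∃ x : α → ℝ, (∀ i, 0 ≤ x i) ∧ (∀ i, x i ≤ 1) ∧ ∑ i, l i * x i = (∑ i, l i ^ q) ^ q⁻¹ ∧
      ∑ i, x i ^ r = 1 := by
  have hq := hqr.lt
  have hA : 0 < ∑ i, l i ^ q := by
    obtain ⟨i, -, hi⟩ : ∃ i ∈ Finset.univ, l i ≠ 0 := by
      apply Finset.exists_ne_zero_of_sum_ne_zero
      rw [h1]; exact one_ne_zero
    exact Finset.sum_pos' (fun i _ => Real.rpow_nonneg (h0 i) q)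
      ⟨i, Finset.mem_univ i, Real.rpow_pos_of_pos (lt_of_le_of_ne (h0 i) hi.symm) q⟩
  obtain ⟨a, ha⟩ : ∃ a, a = (∑ i, l i ^ q) ^ q⁻¹ := ⟨_, rfl⟩
  have ha0 : 0 < a := ha ▸ Real.rpow_pos_of_pos hA _
  have haq : a ^ q = ∑ i, l i ^ q := by
    rw [ha, ← Real.rpow_mul hA.le, inv_mul_cancel₀ (by linarith), Real.rpow_one]
  have hla : ∀ i, l i ≤ a := fun i => by
    rw [← Real.rpow_le_rpow_iff (h0 i) ha0.le (by linarith : 0 < q), haq]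
    exact Finset.single_le_sum (f := fun i => l i ^ q)
      (fun j _ => Real.rpow_nonneg (h0 j) q) (Finset.mem_univ i)
  have hd0 : ∀ i, 0 ≤ l i / a := fun i => div_nonneg (h0 i) ha0.le
  have hdq : ∑ i, (l i / a) ^ q = 1 := by
    simp_rw [Real.div_rpow (h0 _) ha0.le]
    rw [← Finset.sum_div, haq, div_self hA.ne']
  -- The equality case of Hölder. Entries are at most `1` since `l i ≤ ‖l‖_q = a`, and `(q - 1) * r
  -- = q` gives the norm.
  refine ⟨fun i => (l i / a) ^ (q - 1), fun i => Real.rpow_nonneg (hd0 i) _, fun i => ?_, ?_, ?_⟩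
  · exact Real.rpow_le_one (hd0 i) ((div_le_one ha0).2 (hla i)) (by linarith)
  · rw [← ha]
    have : ∀ i, l i * (l i / a) ^ (q - 1) = a * (l i / a) ^ q := fun i => by
      rcases (h0 i).eq_or_lt with h | h
      · rw [← h, zero_div, zero_mul, Real.zero_rpow (by linarith), mul_zero]
      · rw [Real.rpow_sub_one (div_pos h ha0).ne']
        field_simp
    simp_rw [this]
    rw [← Finset.mul_sum, hdq, mul_one]
  · refine Eq.trans ?_ hdq
    refine Finset.sum_congr rfl fun i _ => ?_
    rw [← Real.rpow_mul (hd0 i)]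
    rw [hqr.sub_one_mul_conj]

/-- Subadditivity of the classical Tsallis entropy for `q > 1`, in terms of power sums. -/
theorem sum_rpow_marginals_le {α β : Type*} [Fintype α] [Fintype β] {q : ℝ} (hq : 1 < q)
    (p : α → β → ℝ) (hp : ∀ i j, 0 ≤ p i j) (h1 : ∑ i, ∑ j, p i j = 1) :
    ∑ i, (∑ j, p i j) ^ q + ∑ j, (∑ i, p i j) ^ q ≤ 1 + ∑ i, ∑ j, p i j ^ q := by
  have hqr := Real.HolderConjugate.conjExponent hq
  have hq0 : 0 < q := by linarith
  have hl0 : ∀ i, 0 ≤ ∑ j, p i j := fun i => Finset.sum_nonneg fun j _ => hp i j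
  have hm0 : ∀ j, 0 ≤ ∑ i, p i j := fun j => Finset.sum_nonneg fun i _ => hp i j
  have h1' : ∑ j, ∑ i, p i j = 1 := by rw [Finset.sum_comm]; exact h1
  obtain ⟨x, hx0, hx1, hxl, hxr⟩ := exists_holder_dual_vector hqr _ hl0 h1
  obtain ⟨y, hy0, hy1, hym, hyr⟩ := exists_holder_dual_vector hqr _ hm0 h1'
  have hZ0 : 0 ≤ ∑ i, ∑ j, p i j ^ q :=
    Finset.sum_nonneg fun i _ => Finset.sum_nonneg fun j _ => Real.rpow_nonneg (hp i j) q
  have hA0 : 0 ≤ ∑ i, (∑ j, p i j) ^ q := Finset.sum_nonneg fun i _ => Real.rpow_nonneg (hl0 i) q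
  have hB0 : 0 ≤ ∑ j, (∑ i, p i j) ^ q := Finset.sum_nonneg fun i _ => Real.rpow_nonneg (hm0 i) q
  have hpow : ∀ t : ℝ, 0 ≤ t → (t ^ q⁻¹) ^ q = t := fun t ht => by
    rw [← Real.rpow_mul ht, inv_mul_cancel₀ hq0.ne', Real.rpow_one]
  -- Hölder on `α × β`: the `ℓ^r` norm of the product vector `x i * y j` factors, so it is `1`.
  have holder : ∑ i, ∑ j, p i j * (x i * y j) ≤ (∑ i, ∑ j, p i j ^ q) ^ q⁻¹ := by
    have := Real.inner_le_Lp_mul_Lq_of_nonneg (s := (Finset.univ : Finset (α × β))) hqr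
      (f := fun k => p k.1 k.2) (g := fun k => x k.1 * y k.2) (fun k _ => hp _ _)
      (fun k _ => mul_nonneg (hx0 _) (hy0 _))
    simp only [Fintype.sum_prod_type, Real.mul_rpow (hx0 _) (hy0 _), ← Finset.mul_sum, hyr,
      mul_one, hxr, Real.one_rpow, one_div] at this
    simpa only [Finset.mul_sum] using this
  have hlx : ∑ i, (∑ j, p i j) * x i = ∑ i, ∑ j, p i j * x i := by
    simp_rw [Finset.sum_mul]
  have hmy : ∑ j, (∑ i, p i j) * y j = ∑ i, ∑ j, p i j * y j := by
    simp_rw [Finset.sum_mul]; exact Finset.sum_comm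
  -- This is `(1 - x i) * (1 - y j) ≥ 0` averaged against `p`.
  have hle : ∑ i, ∑ j, p i j * x i + ∑ i, ∑ j, p i j * y j ≤
      ∑ i, ∑ j, p i j + ∑ i, ∑ j, p i j * (x i * y j) := by
    simp only [← Finset.sum_add_distrib]
    refine Finset.sum_le_sum fun i _ => Finset.sum_le_sum fun j _ => ?_
    nlinarith [mul_nonneg (hp i j) (mul_nonneg (sub_nonneg.2 (hx1 i)) (sub_nonneg.2 (hy1 j)))]
  have key := rpow_add_rpow_le_one_add_rpow hq (Real.rpow_nonneg hA0 q⁻¹)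
    (by
      rw [← hxl, ← h1]
      exact Finset.sum_le_sum fun i _ => mul_le_of_le_one_right (hl0 i) (hx1 i))
    (Real.rpow_nonneg hB0 q⁻¹)
    (by
      rw [← hym, ← h1']
      exact Finset.sum_le_sum fun i _ => mul_le_of_le_one_right (hm0 i) (hy1 i))
    (Real.rpow_nonneg hZ0 q⁻¹)
    (by rw [← hxl, ← hym, hlx, hmy]; linarith)
  rwa [hpow _ hA0, hpow _ hB0, hpow _ hZ0] at key

/-! ### Subadditivity of the quantum Tsallis entropy -/

section Quantum
open Matrix

/-- The trace of the functional calculus is a sum over eigenvalues. -/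
theorem trace_cfc_eq_sum_eigenvalues {a : Type*} [Fintype a] [DecidableEq a] {σ : Matrix a a ℂ}
    (hσ : σ.IsHermitian) (f : ℝ → ℝ) :
    (cfc f σ).trace.re = ∑ i, f (hσ.eigenvalues i) := by
  rw [hσ.cfc_eq, IsHermitian.cfc, Unitary.conjStarAlgAut_apply, trace_mul_comm, ← mul_assoc]
  simp [trace]

/-- The diagonal of a Hermitian matrix in another orthonormal basis is the image of its
eigenvalues under a doubly stochastic matrix. -/
theorem conjTranspose_mul_mul_apply_self {a m : Type*} [Fintype a] [DecidableEq a] [Fintype m]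
    [DecidableEq m] {σ : Matrix a a ℂ} (hσ : σ.IsHermitian) (W : Matrix a m ℂ) (i : m) :
    (Wᴴ * σ * W) i i = ((∑ k, Complex.normSq (((hσ.eigenvectorUnitary : Matrix a a ℂ)ᴴ * W) k i) *
      hσ.eigenvalues k : ℝ) : ℂ) := by
  conv_lhs => rw [hσ.spectral_theorem, Unitary.conjStarAlgAut_apply]
  obtain ⟨T, hT⟩ : ∃ T, T = (hσ.eigenvectorUnitary : Matrix a a ℂ)ᴴ * W := ⟨_, rfl⟩
  have hconj : ∀ D : Matrix a a ℂ, Wᴴ * ((hσ.eigenvectorUnitary : Matrix a a ℂ) * D *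
      star (hσ.eigenvectorUnitary : Matrix a a ℂ)) * W = Tᴴ * D * T := fun D => by
    rw [hT, conjTranspose_mul, conjTranspose_conjTranspose, star_eq_conjTranspose]
    simp only [Matrix.mul_assoc]
  rw [hconj, ← hT, mul_apply]
  push_cast
  refine Finset.sum_congr rfl fun k _ => ?_
  rw [mul_diagonal, conjTranspose_apply, Complex.normSq_eq_conj_mul_self]
  simp only [Function.comp_apply, RCLike.star_def, Complex.coe_algebraMap]
  ring_nf

/-- Peierls' inequality for powers: `∑ i, ⟨wᵢ, σ wᵢ⟩ ^ q ≤ Tr σ ^ q` for an orthonormal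
basis `w`. -/
theorem sum_diag_rpow_le_trace_cfc {a m : Type*} [Fintype a] [DecidableEq a] [Fintype m]
    [DecidableEq m] {q : ℝ} (hq : 1 < q) {σ : Matrix a a ℂ} (hσ : σ.PosSemidef)
    (W : Matrix a m ℂ) (hW : Wᴴ * W = 1) (hW' : W * Wᴴ = 1) :
    ∑ i, ((Wᴴ * σ * W) i i).re ^ q ≤ (cfc (fun x : ℝ => x ^ q) σ).trace.re := by
  have hH := hσ.isHermitian
  rw [trace_cfc_eq_sum_eigenvalues hH]
  simp only [conjTranspose_mul_mul_apply_self hH, Complex.ofReal_re]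
  obtain ⟨T, hT⟩ : ∃ T, T = (hH.eigenvectorUnitary : Matrix a a ℂ)ᴴ * W := ⟨_, rfl⟩
  have hU : (hH.eigenvectorUnitary : Matrix a a ℂ) * (hH.eigenvectorUnitary : Matrix a a ℂ)ᴴ = 1 :=
    Unitary.coe_mul_star_self _
  have hU' : (hH.eigenvectorUnitary : Matrix a a ℂ)ᴴ * (hH.eigenvectorUnitary : Matrix a a ℂ) = 1 :=
    Unitary.coe_star_mul_self _
  have hTT : Tᴴ * T = 1 := by
    rw [hT, conjTranspose_mul, conjTranspose_conjTranspose, Matrix.mul_assoc,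
      ← Matrix.mul_assoc _ _ W, hU, Matrix.one_mul, hW]
  have hTT' : T * Tᴴ = 1 := by
    rw [hT, conjTranspose_mul, conjTranspose_conjTranspose, Matrix.mul_assoc,
      ← Matrix.mul_assoc W, hW', Matrix.one_mul, hU']
  rw [← hT]
  -- `T` is unitary, so the `|T k i|²` are doubly stochastic: column sums provide the weights for
  -- Jensen, row sums collapse the result after exchanging summations.
  have hcol : ∀ i, ∑ k, Complex.normSq (T k i) = 1 := fun i => by
    have h := congr_fun (congr_fun hTT i) i
    simp only [mul_apply, conjTranspose_apply, one_apply_eq, RCLike.star_def,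
      ← Complex.normSq_eq_conj_mul_self] at h
    exact_mod_cast h
  have hrow : ∀ k, ∑ i, Complex.normSq (T k i) = 1 := fun k => by
    have h := congr_fun (congr_fun hTT' k) k
    simp only [mul_apply, conjTranspose_apply, one_apply_eq, RCLike.star_def,
      Complex.mul_conj] at h
    exact_mod_cast h
  calc ∑ i, (∑ k, Complex.normSq (T k i) * hH.eigenvalues k) ^ q
      ≤ ∑ i, ∑ k, Complex.normSq (T k i) * hH.eigenvalues k ^ q :=
        Finset.sum_le_sum fun i _ => Real.rpow_arith_mean_le_arith_mean_rpow _ _ _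
          (fun k _ => Complex.normSq_nonneg _) (hcol i)
          (fun k _ => hσ.eigenvalues_nonneg k) hq.le
    _ = ∑ k, hH.eigenvalues k ^ q := by
        rw [Finset.sum_comm]
        simp_rw [← Finset.sum_mul, hrow, one_mul]

/-- The eigenvalues are the diagonal entries in the eigenbasis. -/
theorem eigenvectorUnitary_conj_apply_self {a : Type*} [Fintype a] [DecidableEq a]
    {σ : Matrix a a ℂ} (hσ : σ.IsHermitian) (i : a) :
    ((hσ.eigenvectorUnitary : Matrix a a ℂ)ᴴ * σ * hσ.eigenvectorUnitary) i i =
      hσ.eigenvalues i := by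
  have h : (hσ.eigenvectorUnitary : Matrix a a ℂ)ᴴ * (hσ.eigenvectorUnitary : Matrix a a ℂ) = 1 :=
    Unitary.coe_star_mul_self _
  rw [conjTranspose_mul_mul_apply_self hσ, h, Finset.sum_eq_single i]
  · simp
  · intro b _ hb
    simp [one_apply_ne hb]
  · simp

open scoped Kronecker in
/-- Tracing out the second factor in a product basis. -/
theorem sum_kronecker_conj_apply_snd {a b : Type*} [Fintype a] [Fintype b] [DecidableEq a]
    [DecidableEq b] (ρ : Matrix (a × b) (a × b) ℂ) (U : Matrix a a ℂ) (V : Matrix b b ℂ)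
    (hV : V * Vᴴ = 1) (i : a) :
    ∑ j, ((U ⊗ₖ V)ᴴ * ρ * (U ⊗ₖ V)) (i, j) (i, j) =
      (Uᴴ * (of fun x x' => ∑ y, ρ (x, y) (x', y)) * U) i i := by
  have hVe : ∀ y y', ∑ j, V y j * star (V y' j) = if y = y' then 1 else 0 := fun y y' => by
    have := congr_fun (congr_fun hV y) y'
    simpa [mul_apply, one_apply] using this
  simp only [mul_apply, conjTranspose_apply, kroneckerMap_apply, Fintype.sum_prod_type,
    star_mul', of_apply, Finset.sum_mul, Finset.mul_sum]
  rw [Finset.sum_comm]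
  refine Finset.sum_congr rfl fun x' _ => ?_
  rw [Finset.sum_comm, Finset.sum_comm (γ := a)]
  refine Finset.sum_congr rfl fun y' _ => ?_
  rw [Finset.sum_comm]
  refine Finset.sum_congr rfl fun x _ => ?_
  rw [Finset.sum_comm]
  have : ∀ y : b, ∑ j : b,
      star (U x i) * star (V y j) * ρ (x, y) (x', y') * (U x' i * V y' j) =
      if y' = y then star (U x i) * ρ (x, y) (x', y') * U x' i else 0 := fun y => by
    rw [← mul_boole, ← hVe, Finset.mul_sum]
    exact Finset.sum_congr rfl fun j _ => by ring
  rw [Finset.sum_congr rfl fun y _ => this y, Finset.sum_ite_eq, if_pos (Finset.mem_univ _)]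

open scoped Kronecker in
/-- Tracing out the first factor in a product basis. -/
theorem sum_kronecker_conj_apply_fst {a b : Type*} [Fintype a] [Fintype b] [DecidableEq a]
    [DecidableEq b] (ρ : Matrix (a × b) (a × b) ℂ) (U : Matrix a a ℂ) (V : Matrix b b ℂ)
    (hU : U * Uᴴ = 1) (j : b) :
    ∑ i, ((U ⊗ₖ V)ᴴ * ρ * (U ⊗ₖ V)) (i, j) (i, j) =
      (Vᴴ * (of fun y y' => ∑ x, ρ (x, y) (x, y')) * V) j j := by
  refine Eq.trans ?_ (sum_kronecker_conj_apply_snd (ρ.submatrix Prod.swap Prod.swap) V U hU j)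
  refine Finset.sum_congr rfl fun i _ => ?_
  simp only [mul_apply, conjTranspose_apply, kroneckerMap_apply, submatrix_apply, Prod.swap]
  rw [← (Equiv.prodComm a b).sum_comp]
  refine Finset.sum_congr rfl fun x _ => ?_
  rw [← (Equiv.prodComm a b).sum_comp]
  simp [mul_comm]

open scoped Kronecker in
/-- Subadditivity of the Tsallis entropy for `q > 1`: if `ρ` is a density operator and `σ`, `τ`
are its two partial traces, then `S_q(ρ) ≤ S_q(σ) + S_q(τ)`. -/
theorem tsallisEntropy_le_add {a b c : Type*} [Fintype a] [Fintype b] [Fintype c]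
    [DecidableEq a] [DecidableEq b] [DecidableEq c] {q : ℝ} (hq : 1 < q) (e : c ≃ a × b)
    {ρ : Matrix c c ℂ} {σ : Matrix a a ℂ} {τ : Matrix b b ℂ} (hρ : ρ.PosSemidef)
    (hσ : σ.PosSemidef) (hτ : τ.PosSemidef) (hσ1 : σ.trace = 1)
    (hσρ : ∀ x x', σ x x' = ∑ y, ρ (e.symm (x, y)) (e.symm (x', y)))
    (hτρ : ∀ y y', τ y y' = ∑ x, ρ (e.symm (x, y)) (e.symm (x, y'))) :
    tsallisEntropy q ρ ≤ tsallisEntropy q σ + tsallisEntropy q τ := by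
  have hσH := hσ.isHermitian
  have hτH := hτ.isHermitian
  obtain ⟨U, hU⟩ : ∃ U, U = (hσH.eigenvectorUnitary : Matrix a a ℂ) := ⟨_, rfl⟩
  obtain ⟨V, hV⟩ : ∃ V, V = (hτH.eigenvectorUnitary : Matrix b b ℂ) := ⟨_, rfl⟩
  have hUU : U * Uᴴ = 1 := hU ▸ Unitary.coe_mul_star_self _
  have hVV : V * Vᴴ = 1 := hV ▸ Unitary.coe_mul_star_self _
  have hUU' : Uᴴ * U = 1 := hU ▸ Unitary.coe_star_mul_self _
  have hVV' : Vᴴ * V = 1 := hV ▸ Unitary.coe_star_mul_self _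
  have hW : (U ⊗ₖ V) * (U ⊗ₖ V)ᴴ = 1 := by
    rw [conjTranspose_kronecker, ← mul_kronecker_mul, hUU, hVV, one_kronecker_one]
  have hW' : (U ⊗ₖ V)ᴴ * (U ⊗ₖ V) = 1 := by
    rw [conjTranspose_kronecker, ← mul_kronecker_mul, hUU', hVV', one_kronecker_one]
  -- The columns of `W` are the products of eigenvectors of `σ` and `τ`, transported along `e`.
  obtain ⟨W, hWdef⟩ : ∃ W : Matrix c (a × b) ℂ, W = (U ⊗ₖ V).submatrix e id := ⟨_, rfl⟩
  have hWW : W * Wᴴ = 1 := by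
    rw [hWdef, conjTranspose_submatrix, submatrix_mul _ _ e id e Function.bijective_id |>.symm, hW,
      submatrix_one_equiv]
  have hWW' : Wᴴ * W = 1 := by
    rw [hWdef, conjTranspose_submatrix, submatrix_mul_equiv, hW', submatrix_id_id]
  have hconj : Wᴴ * ρ * W = (U ⊗ₖ V)ᴴ * ρ.submatrix e.symm e.symm * (U ⊗ₖ V) := by
    have : ρ = (ρ.submatrix e.symm e.symm).submatrix e e := by simp
    conv_lhs => rw [this]
    rw [hWdef, conjTranspose_submatrix, submatrix_mul_equiv, submatrix_mul_equiv, submatrix_id_id]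
  obtain ⟨p, hp⟩ : ∃ p : a → b → ℝ, p = fun i j => ((Wᴴ * ρ * W) (i, j) (i, j)).re := ⟨_, rfl⟩
  have hp0 : ∀ i j, 0 ≤ p i j := fun i j => by
    rw [hp]
    exact (Complex.le_def.1 ((hρ.conjTranspose_mul_mul_same W).diag_nonneg (i := (i, j)))).1
  have hpσ : ∀ i, ∑ j, p i j = hσH.eigenvalues i := fun i => by
    have h := sum_kronecker_conj_apply_snd (ρ.submatrix e.symm e.symm) U V hVV i
    have hσ' : (of fun x x' => ∑ y, (ρ.submatrix e.symm e.symm) (x, y) (x', y)) = σ := by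
      ext x x'; simp [hσρ]
    rw [hσ', ← hconj, hU, eigenvectorUnitary_conj_apply_self] at h
    simp only [hp, ← Complex.re_sum, h, Complex.ofReal_re]
  have hpτ : ∀ j, ∑ i, p i j = hτH.eigenvalues j := fun j => by
    have h := sum_kronecker_conj_apply_fst (ρ.submatrix e.symm e.symm) U V hUU j
    have hτ' : (of fun y y' => ∑ x, (ρ.submatrix e.symm e.symm) (x, y) (x, y')) = τ := by
      ext y y'; simp [hτρ]
    rw [hτ', ← hconj, hV, eigenvectorUnitary_conj_apply_self] at h
    simp only [hp, ← Complex.re_sum, h, Complex.ofReal_re]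
  have hp1 : ∑ i, ∑ j, p i j = 1 := by
    simp only [hpσ]
    have h := hσH.trace_eq_sum_eigenvalues
    rw [hσ1, ← RCLike.ofReal_sum, eq_comm] at h
    exact Complex.ofReal_eq_one.1 h
  have hclass := sum_rpow_marginals_le hq p hp0 hp1
  simp only [hpσ, hpτ] at hclass
  have hpeierls := sum_diag_rpow_le_trace_cfc hq hρ W hWW' hWW
  rw [Fintype.sum_prod_type] at hpeierls
  rw [← trace_cfc_eq_sum_eigenvalues hσH (fun x => x ^ q),
    ← trace_cfc_eq_sum_eigenvalues hτH (fun x => x ^ q)] at hclass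
  have hle : (cfc (fun x : ℝ => x ^ q) σ).trace.re + (cfc (fun x : ℝ => x ^ q) τ).trace.re ≤
      1 + (cfc (fun x : ℝ => x ^ q) ρ).trace.re := by
    rw [hp] at hclass
    exact hclass.trans (by linarith)
  unfold tsallisEntropy
  rw [← mul_add]
  -- The prefactor `1 / (1 - q)` is negative and reverses the inequality of power traces.
  exact mul_le_mul_of_nonpos_left (by linarith)
    (one_div_nonpos.2 (by linarith))

end Quantum

/-! ### Marginals and monotonicity of the total correlation -/

section Marginal

variable {ι : Type*} [Fintype ι] [DecidableEq ι] {d : ι → Type*} [∀ i, Fintype (d i)]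

theorem marginal_eq_sum_submatrix (ρ : Matrix (∀ i, d i) (∀ i, d i) ℂ) (J : Finset ι) :
    marginal ρ J = ∑ z : (∀ i : {i // i ∉ J}, d i),
      ρ.submatrix (fun x => (Equiv.piEquivPiSubtypeProd (fun i => i ∈ J) d).symm (x, z))
        (fun x => (Equiv.piEquivPiSubtypeProd (fun i => i ∈ J) d).symm (x, z)) := by
  ext x y
  rw [Matrix.sum_apply]
  rfl

theorem posSemidef_marginal {ρ : Matrix (∀ i, d i) (∀ i, d i) ℂ} (hρ : ρ.PosSemidef)
    (J : Finset ι) : (marginal ρ J).PosSemidef := by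
  rw [marginal_eq_sum_submatrix]
  exact Matrix.posSemidef_sum _ fun z _ => hρ.submatrix _

theorem trace_marginal (ρ : Matrix (∀ i, d i) (∀ i, d i) ℂ) (J : Finset ι) :
    (marginal ρ J).trace = ρ.trace := by
  simp only [Matrix.trace, Matrix.diag_apply, marginal]
  rw [← (Equiv.piEquivPiSubtypeProd (fun i => i ∈ J) d).symm.sum_comp, Fintype.sum_prod_type]

variable [∀ i, DecidableEq (d i)]

/-- The marginal as a sum over all configurations that restrict to `x` on `J`. -/
theorem marginal_apply_eq_sum_ite (ρ : Matrix (∀ i, d i) (∀ i, d i) ℂ) (J : Finset ι)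
    (x x' : ∀ i : {i // i ∈ J}, d i) :
    marginal ρ J x x' = ∑ f : ∀ i, d i, if (fun i : {i // i ∈ J} => f i) = x then
      ρ f (fun i => if h : i ∈ J then x' ⟨i, h⟩ else f i) else 0 := by
  rw [← (Equiv.piEquivPiSubtypeProd (fun i => i ∈ J) d).symm.sum_comp, Fintype.sum_prod_type,
    Finset.sum_comm]
  refine Finset.sum_congr rfl fun z _ => ?_
  rw [Finset.sum_eq_single x]
  · rw [if_pos]
    · congr 1
      ext i
      by_cases h : i ∈ J <;> simp [Equiv.piEquivPiSubtypeProd, h]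
    · ext i
      simp [Equiv.piEquivPiSubtypeProd]
  · intro y _ hy
    rw [if_neg]
    intro h
    apply hy
    rw [← h]
    ext i
    simp [Equiv.piEquivPiSubtypeProd]
  · simp

/-- Marginals are compatible: `ρ_s` is the partial trace of `ρ_u` over `t` if `u` is the disjoint
union of `s` and `t`; the map `g` glues configurations on `s` and on `t`. -/
theorem marginal_apply_eq_sum_marginal (ρ : Matrix (∀ i, d i) (∀ i, d i) ℂ) {s t u : Finset ι}
    (hu : u = s ∪ t)
    (g : (∀ i : {i // i ∈ s}, d i) → (∀ i : {i // i ∈ t}, d i) → ∀ i : {i // i ∈ u}, d i)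
    (hgs : ∀ x y i (hi : i ∈ s) (hiu : i ∈ u), g x y ⟨i, hiu⟩ = x ⟨i, hi⟩)
    (hgt : ∀ x y i (hi : i ∈ t) (hiu : i ∈ u), g x y ⟨i, hiu⟩ = y ⟨i, hi⟩)
    (x x' : ∀ i : {i // i ∈ s}, d i) :
    marginal ρ s x x' = ∑ y, marginal ρ u (g x y) (g x' y) := by
  subst hu
  simp only [marginal_apply_eq_sum_ite]
  rw [Finset.sum_comm]
  refine Finset.sum_congr rfl fun f _ => ?_
  -- For a fixed global configuration `f`, only the `y` that is the restriction of `f` to `t`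
  -- contributes.
  refine Eq.symm ((Finset.sum_eq_single (fun i : {i // i ∈ t} => f i) ?_ ?_).trans ?_)
  · intro y _ hy
    rw [if_neg]
    intro h
    apply hy
    ext ⟨i, hi⟩
    have hiu := Finset.mem_union_right s hi
    rw [← hgt x y i hi hiu, ← h]
  · simp
  · have h1 : (fun i : {i // i ∈ s ∪ t} => f i) = g x (fun i => f i) ↔
        (fun i : {i // i ∈ s} => f i) = x := by
      constructor
      · intro h
        ext ⟨i, hi⟩
        have hiu := Finset.mem_union_left t hi
        rw [← hgs x (fun i => f i) i hi hiu, ← h]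
      · rintro rfl
        ext ⟨i, hi⟩
        rcases Finset.mem_union.1 hi with h | h
        · rw [hgs _ _ i h]
        · rw [hgt _ _ i h]
    rw [ite_cond_congr (propext h1)]
    congr 2
    ext i
    by_cases hs : i ∈ s
    · have hiu := Finset.mem_union_left t hs
      rw [dif_pos hs, dif_pos hiu, hgs _ _ i hs]
    · by_cases ht : i ∈ t
      · have hiu := Finset.mem_union_right s ht
        rw [dif_neg hs, dif_pos hiu, hgt _ _ i ht]
      · rw [dif_neg hs, dif_neg (by simp [hs, ht])]

theorem subsystemEntropy_union_le {ρ : Matrix (∀ i, d i) (∀ i, d i) ℂ} (hρ : IsDensityOperator ρ)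
    {q : ℝ} (hq : 1 < q) {s t : Finset ι} (hst : Disjoint s t) :
    subsystemEntropy q ρ (s ∪ t) ≤ subsystemEntropy q ρ s + subsystemEntropy q ρ t := by
  have hs : ∀ x y i (hi : i ∈ s) (hiu : i ∈ s ∪ t),
      Equiv.piFinsetUnion d hst (x, y) ⟨i, hiu⟩ = x ⟨i, hi⟩ := fun x y i hi hiu =>
    Equiv.piFinsetUnion_left d hst hi hiu
  have ht : ∀ x y i (hi : i ∈ t) (hiu : i ∈ s ∪ t),
      Equiv.piFinsetUnion d hst (x, y) ⟨i, hiu⟩ = y ⟨i, hi⟩ := fun x y i hi hiu =>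
    Equiv.piFinsetUnion_right d hst hi hiu
  exact tsallisEntropy_le_add hq (Equiv.piFinsetUnion d hst).symm
    (posSemidef_marginal hρ.posSemidef _) (posSemidef_marginal hρ.posSemidef _)
    (posSemidef_marginal hρ.posSemidef _) ((trace_marginal ρ s).trans hρ.trace_eq_one)
    (marginal_apply_eq_sum_marginal ρ rfl
      (fun x y => Equiv.piFinsetUnion d hst (x, y)) hs ht)
    (marginal_apply_eq_sum_marginal ρ (Finset.union_comm s t)
      (fun y x => Equiv.piFinsetUnion d hst (x, y)) (fun y x => ht x y) (fun y x => hs x y))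

/-- The increment is `S_q(I) + S_q({v}) - S_q(I ∪ {v})`, nonnegative by subadditivity. -/
theorem totalCorrelation_le_insert {ρ : Matrix (∀ i, d i) (∀ i, d i) ℂ} (hρ : IsDensityOperator ρ)
    {q : ℝ} (hq : 1 < q) {I : Finset ι} {v : ι} (hv : v ∉ I) :
    totalCorrelation q ρ I ≤ totalCorrelation q ρ (insert v I) := by
  have h := subsystemEntropy_union_le hρ hq (Finset.disjoint_singleton_right.2 hv)
  rw [Finset.union_comm, ← Finset.insert_eq] at h
  unfold totalCorrelation
  rw [Finset.sum_insert hv]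
  linarith

theorem totalCorrelation_mono {ρ : Matrix (∀ i, d i) (∀ i, d i) ℂ} (hρ : IsDensityOperator ρ)
    {q : ℝ} (hq : 1 < q) : Monotone (totalCorrelation q ρ) := by
  intro I J hIJ
  have : ∀ T : Finset ι, Disjoint I T →
      totalCorrelation q ρ I ≤ totalCorrelation q ρ (I ∪ T) := fun T => by
    induction T using Finset.induction_on with
    | empty => simp
    | insert v T hv ih =>
      intro hd
      rw [Finset.disjoint_insert_right] at hd
      rw [Finset.union_insert]
      exact (ih hd.2).trans (totalCorrelation_le_insert hρ hq (by simp [hd.1, hv]))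
  rw [← Finset.union_sdiff_of_subset hIJ]
  exact this _ Finset.disjoint_sdiff

theorem isMonotoneFunctional_totalCorrelation {ρ : Matrix (∀ i, d i) (∀ i, d i) ℂ}
    (hρ : IsDensityOperator ρ) {q : ℝ} (hq : 1 < q) :
    IsMonotoneFunctional (totalCorrelation q ρ) :=
  fun _ _ _ h => totalCorrelation_mono hρ hq h

theorem subsystemEntropy_empty {ρ : Matrix (∀ i, d i) (∀ i, d i) ℂ} (hρ : IsDensityOperator ρ)
    {q : ℝ} : subsystemEntropy q ρ ∅ = 0 := by
  have hP := posSemidef_marginal hρ.posSemidef (∅ : Finset ι)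
  have h := hP.isHermitian.trace_eq_sum_eigenvalues
  rw [trace_marginal, hρ.trace_eq_one, Fintype.sum_unique, eq_comm] at h
  have h1 : hP.isHermitian.eigenvalues default = 1 := Complex.ofReal_eq_one.1 h
  unfold subsystemEntropy tsallisEntropy
  rw [trace_cfc_eq_sum_eigenvalues hP.isHermitian, Fintype.sum_unique, h1]
  simp

theorem totalCorrelation_empty {ρ : Matrix (∀ i, d i) (∀ i, d i) ℂ} (hρ : IsDensityOperator ρ)
    {q : ℝ} : totalCorrelation q ρ ∅ = 0 := by
  simp [totalCorrelation, subsystemEntropy_empty hρ]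

theorem totalCorrelation_singleton (q : ℝ) (ρ : Matrix (∀ i, d i) (∀ i, d i) ℂ) (v : ι) :
    totalCorrelation q ρ {v} = 0 := by
  simp [totalCorrelation]

end Marginal

/-! ### The augmented chain complex and the Euler–Poincaré formula -/

section Homology

theorem sum_neg_one_pow_card_eq_zero {ι : Type*} [Fintype ι] [Nonempty ι] :
    ∑ J : Finset ι, (-1 : ℝ) ^ J.card = 0 := by
  have := Finset.sum_powerset_neg_one_pow_card_of_nonempty
    (Finset.univ_nonempty : (Finset.univ : Finset ι).Nonempty)
  rw [Finset.powerset_univ] at this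
  exact_mod_cast this

theorem card_filter_lt_erase {ι : Type*} [LinearOrder ι] (J : Finset ι) {v w : ι} (hv : v ∈ J)
    (h : v < w) : ((J.erase v).filter (· < w)).card + 1 = (J.filter (· < w)).card := by
  rw [Finset.filter_erase, Finset.card_erase_add_one (Finset.mem_filter.2 ⟨hv, h⟩)]

theorem filter_lt_erase_of_le {ι : Type*} [LinearOrder ι] (J : Finset ι) {v w : ι} (h : w ≤ v) :
    (J.erase v).filter (· < w) = J.filter (· < w) := by
  rw [Finset.filter_erase, Finset.erase_eq_of_notMem]
  simp [h]

theorem augmentedChains_eq_bot {K : Type*} [Field K] {ι : Type*} [Fintype ι]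
    (G : PreAbstractSimplicialComplex ι) {m : ℕ} (hm : Fintype.card ι < m) :
    augmentedChains K G m = ⊥ := by
  refine (Submodule.eq_bot_iff _).2 fun c hc => ?_
  ext J
  by_contra h
  exact absurd ((hc J h).2 ▸ J.card_le_univ) (not_le.2 hm)

/-- The two signs of a face of codimension two cancel. -/
theorem boundary_sign_add_eq_zero {K : Type*} [Field K] {ι : Type*} [LinearOrder ι]
    (J : Finset ι) {v w : ι} (hv : v ∈ J) (hw : w ∈ J)
    (hvw : v ≠ w) :
    (-1 : K) ^ (J.filter (· < v)).card * (-1) ^ ((J.erase v).filter (· < w)).card +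
      (-1 : K) ^ (J.filter (· < w)).card * (-1) ^ ((J.erase w).filter (· < v)).card = 0 := by
  wlog h : v < w generalizing v w
  · rw [add_comm]
    exact this hw hv hvw.symm (lt_of_le_of_ne (not_lt.1 h) hvw.symm)
  rw [filter_lt_erase_of_le J h.le, ← card_filter_lt_erase J hv h, pow_succ]
  ring

theorem single_mem_augmentedChains {K : Type*} [Field K] {ι : Type*} [DecidableEq ι]
    {G : PreAbstractSimplicialComplex ι} {m : ℕ} {J : Finset ι}
    (hJ : J = ∅ ∨ J ∈ G.faces) (hm : J.card = m) (r : K) :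
    Pi.single J r ∈ augmentedChains K G m := by
  intro I hI
  by_cases h : I = J
  · subst h; exact ⟨hJ, hm⟩
  · exact absurd (by simp [h]) hI

variable {K : Type*} [Field K] {ι : Type*} [Fintype ι] [LinearOrder ι]

theorem simplicialBoundary_single (J : Finset ι) (r : K) :
    simplicialBoundary K ι (Pi.single J r) =
      ∑ v ∈ J, Pi.single (J.erase v) (r * (-1 : K) ^ (J.filter (· < v)).card) := by
  rw [simplicialBoundary, Fintype.linearCombination_apply_single, Finset.smul_sum]
  exact Finset.sum_congr rfl fun v _ => by rw [← Pi.single_smul, smul_eq_mul]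

/-- Deleting `v` then `w`, or `w` then `v`, gives the same face with opposite signs; swapping the
pair is a fixed-point-free involution on the terms of `∂∂J`. -/
theorem simplicialBoundary_comp_self :
    simplicialBoundary K ι ∘ₗ simplicialBoundary K ι = 0 := by
  refine LinearMap.pi_ext' fun J => LinearMap.ext_ring ?_
  simp only [LinearMap.comp_apply, LinearMap.single_apply, LinearMap.zero_apply,
    simplicialBoundary_single, map_sum, one_mul]
  rw [Finset.sum_sigma']
  refine Finset.sum_involution (fun p _ => ⟨p.2, p.1⟩) ?_ ?_ ?_ ?_
  · rintro ⟨v, w⟩ h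
    simp only [Finset.mem_sigma, Finset.mem_erase] at h
    dsimp only
    rw [Finset.erase_right_comm, ← Pi.single_add,
      boundary_sign_add_eq_zero J h.1 h.2.2 (Ne.symm h.2.1), Pi.single_zero]
  · rintro ⟨v, w⟩ h - heq
    simp only [Finset.mem_sigma, Finset.mem_erase] at h
    exact h.2.1 (congrArg Sigma.fst heq)
  · rintro ⟨v, w⟩ h
    simp only [Finset.mem_sigma, Finset.mem_erase] at h ⊢
    exact ⟨h.2.2, Ne.symm h.2.1, h.1⟩
  · rintro ⟨v, w⟩ h
    rfl

theorem map_simplicialBoundary_le (G : PreAbstractSimplicialComplex ι) (m : ℕ) :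
    (augmentedChains K G (m + 1)).map (simplicialBoundary K ι) ≤ augmentedChains K G m := by
  rintro _ ⟨c, hc, rfl⟩
  rw [simplicialBoundary, Fintype.linearCombination_apply]
  refine Submodule.sum_mem _ fun J _ => ?_
  by_cases h : c J = 0
  · rw [h, zero_smul]; exact Submodule.zero_mem _
  · obtain ⟨hJ, hm⟩ := hc J h
    refine Submodule.smul_mem _ _ (Submodule.sum_mem _ fun v hv => ?_)
    refine single_mem_augmentedChains ?_ ?_ _
    · rcases hJ with rfl | hJ
      · simp at hv
      · rcases (J.erase v).eq_empty_or_nonempty with h0 | h0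
        · exact Or.inl h0
        · exact Or.inr ((G.isRelLowerSet_faces hJ).2 (Finset.erase_subset _ _) h0)
    · rw [Finset.card_erase_of_mem hv, hm]; rfl

theorem reducedBoundaries_le_reducedCycles (G : PreAbstractSimplicialComplex ι) (k : ℕ) :
    reducedBoundaries K G k ≤ reducedCycles K G k := by
  refine le_inf (map_simplicialBoundary_le G (k + 1)) ?_
  rintro _ ⟨c, -, rfl⟩
  exact LinearMap.congr_fun simplicialBoundary_comp_self c

/-- Rank–nullity for the boundary on `k`-chains. The image is not written with `reducedBoundaries`,
because for `k = 0` it is that of the augmentation, in dimension `-1`. -/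
theorem finrank_reducedCycles_add (G : PreAbstractSimplicialComplex ι) (k : ℕ) :
    Module.finrank K (reducedCycles K G k) +
      Module.finrank K ((augmentedChains K G (k + 1)).map (simplicialBoundary K ι)) =
      Module.finrank K (augmentedChains K G (k + 1)) := by
  have h := ((simplicialBoundary K ι).domRestrict
    (augmentedChains K G (k + 1))).finrank_range_add_finrank_ker
  have hle : reducedCycles K G k ≤ augmentedChains K G (k + 1) := inf_le_left
  have hker : LinearMap.ker ((simplicialBoundary K ι).domRestrict (augmentedChains K G (k + 1))) =
      (reducedCycles K G k).submoduleOf (augmentedChains K G (k + 1)) := by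
    ext x
    simp [reducedCycles, Submodule.submoduleOf]
  rw [LinearMap.range_domRestrict, hker,
    (Submodule.submoduleOfEquivOfLe hle).finrank_eq] at h
  omega

theorem finrank_reducedHomology_add (G : PreAbstractSimplicialComplex ι) (k : ℕ) :
    Module.finrank K (ReducedHomology K G k) + Module.finrank K (reducedBoundaries K G k) =
      Module.finrank K (reducedCycles K G k) := by
  rw [← (Submodule.submoduleOfEquivOfLe (reducedBoundaries_le_reducedCycles G k)).finrank_eq]
  exact Submodule.finrank_quotient_add_finrank _

open Classical in
theorem finrank_augmentedChains (G : PreAbstractSimplicialComplex ι) (m : ℕ) :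
    Module.finrank K (augmentedChains K G m) =
      ∑ J : Finset ι, if (J = ∅ ∨ J ∈ G.faces) ∧ J.card = m then 1 else 0 := by
  let P : Finset ι → Prop := fun J => (J = ∅ ∨ J ∈ G.faces) ∧ J.card = m
  let e : augmentedChains K G m ≃ₗ[K] ({J // P J} → K) :=
    { toFun := fun c J => c.1 J
      map_add' := fun _ _ => rfl
      map_smul' := fun _ _ => rfl
      invFun := fun f => ⟨fun J => if h : P J then f ⟨J, h⟩ else 0, fun J hJ => by
        by_contra h
        exact hJ (dif_neg h)⟩
      left_inv := fun c => by
        ext J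
        by_cases h : P J
        · simp [h]
        · simp only [h, dite_false]
          by_contra h0
          exact h (c.2 J (Ne.symm h0))
      right_inv := fun f => by
        ext J
        simp [J.2] }
  rw [e.finrank_eq, Module.finrank_fintype_fun_eq_card, Fintype.card_subtype, Finset.card_filter]

theorem finrank_reducedHomology_eq_zero_of_card_le (G : PreAbstractSimplicialComplex ι) {k : ℕ}
    (hk : Fintype.card ι ≤ k) : Module.finrank K (ReducedHomology K G k) = 0 := by
  have h1 := finrank_reducedHomology_add (K := K) G k
  have h2 := finrank_reducedCycles_add (K := K) G k
  rw [augmentedChains_eq_bot G (Nat.lt_succ_of_le hk), finrank_bot] at h2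
  omega

/-- The image of the augmentation is one-dimensional if there is a vertex. -/
theorem finrank_map_augmentation (G : PreAbstractSimplicialComplex ι) {v : ι}
    (hv : {v} ∈ G.faces) :
    Module.finrank K ((augmentedChains K G 1).map (simplicialBoundary K ι)) = 1 := by
  have h : (augmentedChains K G 1).map (simplicialBoundary K ι) = augmentedChains K G 0 := by
    refine le_antisymm (map_simplicialBoundary_le G 0) fun c hc => ?_
    refine ⟨Pi.single {v} (c ∅), single_mem_augmentedChains (Or.inr hv) (by simp) _, ?_⟩
    rw [simplicialBoundary_single]
    ext J
    by_cases hJ : J = ∅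
    · subst hJ; simp [Finset.filter_singleton]
    · have : c J = 0 := by
        by_contra h0
        exact hJ (Finset.card_eq_zero.1 (hc J h0).2)
      simp [this, hJ]
  classical
  rw [h, finrank_augmentedChains, Finset.sum_eq_single ∅]
  · simp
  · intro J _ hJ
    rw [if_neg]
    rintro ⟨-, h0⟩
    exact hJ (Finset.card_eq_zero.1 h0)
  · simp

/-- By rank–nullity, `dim H_k = dim C_k - rank ∂_k - rank ∂_{k+1}`. The alternating sum telescopes,
leaving the rank of the augmentation and the last rank. -/
theorem alternating_sum_finrank_reducedHomology (G : PreAbstractSimplicialComplex ι) (N : ℕ) :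
    ∑ k ∈ Finset.range N, (-1 : ℝ) ^ k * Module.finrank K (ReducedHomology K G k) =
      ∑ k ∈ Finset.range N, (-1 : ℝ) ^ k * Module.finrank K (augmentedChains K G (k + 1))
        - Module.finrank K ((augmentedChains K G 1).map (simplicialBoundary K ι))
        + (-1) ^ N *
          Module.finrank K ((augmentedChains K G (N + 1)).map (simplicialBoundary K ι)) := by
  induction N with
  | zero => simp
  | succ N ih =>
    have h1 := finrank_reducedHomology_add (K := K) G N
    have h2 := finrank_reducedCycles_add (K := K) G N
    have h1' : (Module.finrank K (ReducedHomology K G N) : ℝ) + Module.finrank K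
      ((augmentedChains K G (N + 2)).map (simplicialBoundary K ι)) =
      Module.finrank K (reducedCycles K G N) := by exact_mod_cast h1
    have h2' : (Module.finrank K (reducedCycles K G N) : ℝ) +
      Module.finrank K ((augmentedChains K G (N + 1)).map (simplicialBoundary K ι)) =
      Module.finrank K (augmentedChains K G (N + 1)) := by exact_mod_cast h2
    rw [Finset.sum_range_succ, Finset.sum_range_succ, ih, ← h2', ← h1', pow_succ]
    ring

open Classical in
/-- The Euler–Poincaré formula for the augmented chain complex. -/
theorem alternating_sum_reducedBetti_eq (G : PreAbstractSimplicialComplex ι) {v : ι}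
    (hv : {v} ∈ G.faces) :
    ∑ k ∈ Finset.range (Fintype.card ι),
      (-1 : ℝ) ^ k * Module.finrank K (ReducedHomology K G k) =
      ∑ J : Finset ι, if J = ∅ ∨ J ∈ G.faces then 0 else (-1 : ℝ) ^ J.card := by
  rw [alternating_sum_finrank_reducedHomology, finrank_map_augmentation G hv,
    augmentedChains_eq_bot G (Nat.lt_succ_self _), Submodule.map_bot, finrank_bot]
  -- Each nonempty face is counted once, at `k = |J| - 1`, which accounts for the minus sign.
  have hchains : ∑ k ∈ Finset.range (Fintype.card ι),
      (-1 : ℝ) ^ k * Module.finrank K (augmentedChains K G (k + 1)) =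
      ∑ J : Finset ι, if J ≠ ∅ ∧ J ∈ G.faces then -(-1 : ℝ) ^ J.card else 0 := by
    simp only [finrank_augmentedChains, Nat.cast_sum, Finset.mul_sum]
    rw [Finset.sum_comm]
    refine Finset.sum_congr rfl fun J _ => ?_
    by_cases hJ : J = ∅
    · simp [hJ]
    · rw [Finset.sum_eq_single (J.card - 1)]
      · have hpos : 0 < J.card := Finset.card_pos.2 (Finset.nonempty_iff_ne_empty.2 hJ)
        obtain ⟨c, hc⟩ : ∃ c, J.card = c + 1 := ⟨J.card - 1, by omega⟩
        simp [hc, hJ, pow_succ]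
      · intro k _ hk
        rw [if_neg]
        · simp
        · rintro ⟨-, h⟩
          omega
      · intro h
        exfalso
        apply h
        rw [Finset.mem_range]
        have hpos : 0 < J.card := Finset.card_pos.2 (Finset.nonempty_iff_ne_empty.2 hJ)
        have := J.card_le_univ
        omega
  have : Nonempty ι := ⟨v⟩
  have hempty : ∑ J : Finset ι, (if J = ∅ then (1 : ℝ) else 0) = 1 := by simp
  rw [hchains, Nat.cast_one, Nat.cast_zero, mul_zero, add_zero]
  -- The `1` from the augmentation becomes the term of `J = ∅`; the two sides then differ by the
  -- full alternating sum over all subsets, which vanishes.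
  refine (congrArg₂ (· - ·) rfl hempty.symm).trans ?_
  rw [← Finset.sum_sub_distrib, ← sub_eq_zero, ← Finset.sum_sub_distrib, ← neg_eq_zero,
    ← Finset.sum_neg_distrib]
  refine Eq.trans ?_ (sum_neg_one_pow_card_eq_zero (ι := ι))
  refine Finset.sum_congr rfl fun J _ => ?_
  by_cases hJ : J = ∅
  · simp [hJ]
  · by_cases hG : J ∈ G.faces <;> simp [hJ, hG]

/-! ### Acyclicity of the full simplex -/

/-- The cone operator with apex `a`. -/
noncomputable def coneOperator (K : Type*) [Field K] (a : ι) :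
    (Finset ι → K) →ₗ[K] (Finset ι → K) :=
  Fintype.linearCombination K fun J : Finset ι =>
    if a ∈ J then 0 else Pi.single (insert a J) (1 : K)

theorem coneOperator_single (a : ι) (J : Finset ι) (r : K) :
    coneOperator K a (Pi.single J r) = if a ∈ J then 0 else Pi.single (insert a J) r := by
  rw [coneOperator, Fintype.linearCombination_apply_single]
  split_ifs
  · simp
  · rw [← Pi.single_smul, smul_eq_mul, mul_one]

/-- The cone operator over the least vertex is a contracting homotopy. -/
theorem boundary_cone_add_cone_boundary {a : ι} (ha : ∀ i, a ≤ i) (c : Finset ι → K) :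
    simplicialBoundary K ι (coneOperator K a c) + coneOperator K a (simplicialBoundary K ι c) =
      c := by
  suffices h : simplicialBoundary K ι ∘ₗ coneOperator K a +
      coneOperator K a ∘ₗ simplicialBoundary K ι = LinearMap.id from LinearMap.congr_fun h c
  refine LinearMap.pi_ext' fun J => LinearMap.ext_ring ?_
  simp only [LinearMap.comp_apply, LinearMap.single_apply, LinearMap.add_apply, LinearMap.id_apply,
    simplicialBoundary_single, map_sum, coneOperator_single, one_mul]
  have hfilter : ∀ I : Finset ι, I.filter (· < a) = ∅ := fun I =>
    Finset.filter_eq_empty_iff.2 fun i _ => not_lt.2 (ha i)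
  -- If `a ∈ J`, coning kills `J` and every face except `J.erase a`, whose cone is `J`. Otherwise
  -- `∂(a * J) = J - a * ∂J`: as `a` is least, it comes first and shifts every other sign by one.
  by_cases hJ : a ∈ J
  · rw [if_pos hJ, map_zero, zero_add, Finset.sum_eq_single a]
    · simp [hfilter, Finset.insert_erase hJ]
    · intro v _ hv
      rw [if_pos (Finset.mem_erase.2 ⟨hv.symm, hJ⟩)]
    · exact fun h => absurd hJ h
  · rw [if_neg hJ, simplicialBoundary_single, Finset.sum_insert hJ, Finset.erase_insert hJ,
      hfilter, Finset.card_empty, pow_zero, mul_one, add_assoc, ← Finset.sum_add_distrib,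
      Finset.sum_eq_zero, add_zero]
    intro v hv
    have hav : a ≠ v := fun h => hJ (h ▸ hv)
    rw [if_neg (fun h => hJ (Finset.mem_of_mem_erase h)), Finset.erase_insert_of_ne hav,
      ← Pi.single_add, Finset.filter_insert, if_pos (lt_of_le_of_ne (ha v) hav),
      Finset.card_insert_of_notMem (fun h => hJ (Finset.mem_filter.1 h).1), pow_succ]
    simp

/-- A cycle is the boundary of its cone, and the cone is a chain of `G` since every nonempty set is
a face. -/
theorem finrank_reducedHomology_full [Nonempty ι] (G : PreAbstractSimplicialComplex ι)
    (hG : ∀ J : Finset ι, J.Nonempty → J ∈ G.faces) (k : ℕ) :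
    Module.finrank K (ReducedHomology K G k) = 0 := by
  obtain ⟨a, ha⟩ : ∃ a : ι, ∀ i, a ≤ i := Finite.exists_min id
  have hle : reducedCycles K G k ≤ reducedBoundaries K G k := by
    rintro c ⟨hc, hker⟩
    refine ⟨coneOperator K a c, ?_, ?_⟩
    · rw [coneOperator, Fintype.linearCombination_apply]
      refine Submodule.sum_mem _ fun J _ => ?_
      by_cases h : c J = 0
      · rw [h, zero_smul]; exact Submodule.zero_mem _
      · refine Submodule.smul_mem _ _ ?_
        split_ifs with haJ
        · exact Submodule.zero_mem _
        · refine single_mem_augmentedChains (Or.inr (hG _ (Finset.insert_nonempty _ _))) ?_ _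
          rw [Finset.card_insert_of_notMem haJ, (hc J h).2]
    · have h := boundary_cone_add_cone_boundary ha c
      rwa [LinearMap.mem_ker.1 hker, map_zero, add_zero] at h
  have h1 := finrank_reducedHomology_add (K := K) G k
  have h2 := Submodule.finrank_mono hle
  omega

end Homology

/-! ### The integrated Euler characteristic of a monotone functional -/

section Filtration

open MeasureTheory

variable {K : Type*} [Field K] {ι : Type*} [Fintype ι] [LinearOrder ι] {F : Finset ι → ℝ}

/-- The Betti number depends on `t` only through the predicate `J ↦ F J ≤ t`, which varies
measurably with `t` in a finite space, where every function is measurable. -/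
theorem measurable_reducedBetti (hF : IsMonotoneFunctional F) (k : ℕ) :
    Measurable fun t : ℝ => (reducedBetti K F hF k t : ℝ) := by
  let A : ℝ → Finset ι → Prop := fun t J => F J ≤ t
  have hA : Measurable A := measurable_pi_lambda _ fun J =>
    measurableSet_setOfPred.1 (measurableSet_Ici (a := F J))
  have hfac : Function.FactorsThrough (fun t : ℝ => (reducedBetti K F hF k t : ℝ)) A := by
    intro t u htu
    have h : sublevelComplex F hF t = sublevelComplex F hF u := by
      ext J
      exact and_congr_right fun _ => iff_of_eq (congr_fun htu J)
    exact congrArg (fun G => (Module.finrank K (ReducedHomology K G k) : ℝ)) h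
  have heq : (fun t : ℝ => (reducedBetti K F hF k t : ℝ)) =
      Function.extend A (fun t : ℝ => (reducedBetti K F hF k t : ℝ)) 0 ∘ A := by
    ext t
    exact (hfac.extend_apply 0 t).symm
  rw [heq]
  exact (measurable_of_finite _).comp hA

theorem reducedBetti_le_card (hF : IsMonotoneFunctional F) (k : ℕ) (t : ℝ) :
    reducedBetti K F hF k t ≤ Fintype.card (Finset ι) := by
  have h1 := finrank_reducedHomology_add (K := K) (sublevelComplex F hF t) k
  have h2 := Submodule.finrank_le (reducedCycles K (sublevelComplex F hF t) k)
  rw [Module.finrank_fintype_fun_eq_card] at h2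
  unfold reducedBetti
  omega

theorem reducedBetti_eq_zero_of_univ_le [Nonempty ι] (hF : IsMonotoneFunctional F) (k : ℕ) {t : ℝ}
    (ht : F Finset.univ ≤ t) : reducedBetti K F hF k t = 0 :=
  finrank_reducedHomology_full (sublevelComplex F hF t)
    (fun J hJ => ⟨hJ, (hF J Finset.univ hJ (Finset.subset_univ J)).trans ht⟩) k

theorem integrableOn_reducedBetti [Nonempty ι] (hF : IsMonotoneFunctional F) (k : ℕ) :
    IntegrableOn (fun t : ℝ => (reducedBetti K F hF k t : ℝ)) (Set.Ioi 0) := by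
  have hb : Integrable ((Set.Ioc 0 (F Finset.univ)).indicator
      fun _ => (Fintype.card (Finset ι) : ℝ)) (volume.restrict (Set.Ioi (0 : ℝ))) := by
    refine Integrable.restrict ?_
    rw [integrable_indicator_iff measurableSet_Ioc]
    exact integrableOn_const (by simp)
  refine hb.mono' (measurable_reducedBetti hF k).aestronglyMeasurable ?_
  filter_upwards [ae_restrict_mem measurableSet_Ioi] with t ht
  rw [Real.norm_of_nonneg (Nat.cast_nonneg _)]
  by_cases h : t ≤ F Finset.univ
  · rw [Set.indicator_of_mem (show t ∈ Set.Ioc 0 (F Finset.univ) from ⟨ht, h⟩)]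
    exact_mod_cast reducedBetti_le_card hF k t
  · rw [reducedBetti_eq_zero_of_univ_le hF k (not_le.1 h).le, Nat.cast_zero]
    exact Set.indicator_nonneg (fun _ _ => Nat.cast_nonneg _) t

theorem reducedIntegratedBetti_eq_zero_of_card_le (hF : IsMonotoneFunctional F) {k : ℕ}
    (hk : Fintype.card ι ≤ k) (ε : ℝ) : reducedIntegratedBetti K F hF k ε = 0 := by
  simp [reducedIntegratedBetti, reducedBetti, finrank_reducedHomology_eq_zero_of_card_le _ hk]

theorem summable_reducedIntegratedBetti (hF : IsMonotoneFunctional F) (ε : ℝ) :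
    Summable fun k : ℕ => (-1 : ℝ) ^ k * reducedIntegratedBetti K F hF k ε :=
  summable_of_ne_finset_zero (s := Finset.range (Fintype.card ι)) fun k hk => by
    rw [reducedIntegratedBetti_eq_zero_of_card_le hF (by simpa using hk), mul_zero]

theorem reducedIntegratedEulerChar_eq_sum (hF : IsMonotoneFunctional F) (ε : ℝ) :
    reducedIntegratedEulerChar K F hF ε = ∑ k ∈ Finset.range (Fintype.card ι),
      (-1 : ℝ) ^ k * reducedIntegratedBetti K F hF k ε :=
  tsum_eq_sum fun k hk => by
    rw [reducedIntegratedBetti_eq_zero_of_card_le hF (by simpa using hk), mul_zero]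

theorem integral_ite_le_zero_const {a ε c : ℝ} (h0 : 0 ≤ a) (h1 : a ≤ ε) :
    ∫ t in (0 : ℝ)..ε, (if a ≤ t then 0 else c) = c * a := by
  have h : (fun t : ℝ => if a ≤ t then 0 else c) = (Set.Iio a).indicator fun _ => c := by
    ext t
    by_cases ht : a ≤ t
    · simp [ht]
    · simp [ht, not_le.1 ht]
  have hset : Set.Ioc 0 ε ∩ Set.Iio a = Set.Ioo 0 a := by
    ext t
    simp only [Set.mem_inter_iff, Set.mem_Ioc, Set.mem_Iio, Set.mem_Ioo]
    constructor
    · rintro ⟨⟨h, -⟩, h'⟩; exact ⟨h, h'⟩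
    · rintro ⟨h, h'⟩; exact ⟨⟨h, by linarith⟩, h'⟩
  rw [intervalIntegral.integral_of_le (h0.trans h1), h, setIntegral_indicator measurableSet_Iio,
    hset, setIntegral_const, Real.volume_real_Ioo_of_le h0]
  simp [mul_comm]

theorem intervalIntegrable_ite_le (a c u v : ℝ) :
    IntervalIntegrable (fun t : ℝ => if a ≤ t then 0 else c) volume u v := by
  have h : (fun t : ℝ => if a ≤ t then 0 else c) = (Set.Iio a).indicator fun _ => c := by
    ext t
    by_cases ht : a ≤ t
    · simp [ht]
    · simp [ht, not_le.1 ht]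
  rw [h, intervalIntegrable_iff]
  exact (integrableOn_const (by simp)).indicator measurableSet_Iio

/-- The integrated Euler characteristic up to any `ε` beyond the largest filtration value is the
alternating sum of the values of the functional. -/
theorem reducedIntegratedEulerChar_eq_of_univ_le [Nonempty ι] (hF : IsMonotoneFunctional F)
    (hempty : F ∅ = 0) (hsingle : ∀ v, F {v} = 0) {ε : ℝ} (hε : F Finset.univ ≤ ε) :
    reducedIntegratedEulerChar K F hF ε = ∑ J : Finset ι, (-1 : ℝ) ^ J.card * F J := by
  have hnonneg : ∀ J, 0 ≤ F J := fun J => by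
    rcases J.eq_empty_or_nonempty with rfl | ⟨v, hv⟩
    · exact hempty.ge
    · rw [← hsingle v]
      exact hF _ _ (Finset.singleton_nonempty v) (Finset.singleton_subset_iff.2 hv)
  have hle : ∀ J, F J ≤ ε := fun J => by
    rcases J.eq_empty_or_nonempty with rfl | hJ
    · exact hempty.le.trans ((hnonneg _).trans hε)
    · exact (hF J _ hJ (Finset.subset_univ J)).trans hε
  have hε0 : 0 ≤ ε := (hnonneg _).trans hε
  have hint : ∀ k ∈ Finset.range (Fintype.card ι), IntervalIntegrable
      (fun t => (-1 : ℝ) ^ k * (reducedBetti K F hF k t : ℝ)) volume 0 ε := fun k _ => by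
    refine IntervalIntegrable.const_mul ?_ _
    rw [intervalIntegrable_iff_integrableOn_Ioc_of_le hε0]
    exact (integrableOn_reducedBetti hF k).mono_set Set.Ioc_subset_Ioi_self
  rw [reducedIntegratedEulerChar_eq_sum]
  simp only [reducedIntegratedBetti, ← intervalIntegral.integral_const_mul]
  rw [← intervalIntegral.integral_finsetSum hint]
  -- The Euler–Poincaré formula needs a vertex in the complex, hence `t ≥ 0`.
  have hEuler : ∀ t ∈ Set.uIcc 0 ε, ∑ k ∈ Finset.range (Fintype.card ι),
      (-1 : ℝ) ^ k * (reducedBetti K F hF k t : ℝ) =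
      ∑ J : Finset ι, if F J ≤ t then 0 else (-1 : ℝ) ^ J.card := fun t ht => by
    rw [Set.uIcc_of_le hε0] at ht
    have hv : {Classical.arbitrary ι} ∈ (sublevelComplex F hF t).faces :=
      ⟨Finset.singleton_nonempty _, (hsingle _).trans_le ht.1⟩
    refine (alternating_sum_reducedBetti_eq _ hv).trans (Finset.sum_congr rfl fun J _ => ?_)
    -- Since `F ∅ = 0 ≤ t`, the ever-present empty simplex obeys the same criterion as the other
    -- faces.
    have : (J = ∅ ∨ J ∈ (sublevelComplex F hF t).faces) ↔ F J ≤ t := by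
      rcases J.eq_empty_or_nonempty with rfl | hJ
      · exact ⟨fun _ => hempty.trans_le ht.1, fun _ => Or.inl rfl⟩
      · exact ⟨fun h => (h.resolve_left hJ.ne_empty).2, fun h => Or.inr ⟨hJ, h⟩⟩
    simp only [this]
  rw [intervalIntegral.integral_congr hEuler,
    intervalIntegral.integral_finsetSum fun J _ => intervalIntegrable_ite_le _ _ _ _]
  exact Finset.sum_congr rfl fun J _ => integral_ite_le_zero_const (hnonneg J) (hle J)

end Filtration

/-! ### Interaction information as an alternating sum of total correlations -/

/-- The sum over all sets vanishes, and so does the sum over sets avoiding `v`, as these are the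
subsets of a nonempty set when there is a second party. -/
theorem sum_neg_one_pow_card_mem_eq_zero {ι : Type*} [Fintype ι] [DecidableEq ι] [Nontrivial ι]
    (v : ι) : ∑ J : Finset ι, (if v ∈ J then (-1 : ℝ) ^ J.card else 0) = 0 := by
  have htot := sum_neg_one_pow_card_eq_zero (ι := ι)
  obtain ⟨w, hw⟩ := exists_ne v
  have hne : ((Finset.univ : Finset ι).erase v).Nonempty := ⟨w, by simp [hw]⟩
  have herase := Finset.sum_powerset_neg_one_pow_card_of_nonempty hne
  have hset : ((Finset.univ : Finset ι).erase v).powerset =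
      Finset.univ.filter fun J => v ∉ J := by
    ext J
    simp [Finset.subset_erase]
  rw [hset] at herase
  have herase' : ∑ J : Finset ι with v ∉ J, (-1 : ℝ) ^ J.card = 0 := by exact_mod_cast herase
  rw [← Finset.sum_filter]
  rw [← Finset.sum_filter_add_sum_filter_not Finset.univ (fun J : Finset ι => v ∈ J), herase',
    add_zero] at htot
  exact htot

/-- The coefficient of `S_q({v})` is the alternating sum over the sets containing `v`, which is
zero; only the joint entropies remain. -/
theorem sum_neg_one_pow_mul_totalCorrelation {ι : Type*} [Fintype ι] [DecidableEq ι] [Nontrivial ι]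
    {d : ι → Type*} [∀ i, Fintype (d i)] [∀ i, DecidableEq (d i)] (q : ℝ)
    (ρ : Matrix (∀ i, d i) (∀ i, d i) ℂ) :
    ∑ J : Finset ι, (-1 : ℝ) ^ J.card * totalCorrelation q ρ J = interactionInformation q ρ := by
  have hlocal : ∑ J : Finset ι, (-1 : ℝ) ^ J.card * ∑ v ∈ J, subsystemEntropy q ρ {v} = 0 := by
    have : ∀ J : Finset ι, (-1 : ℝ) ^ J.card * ∑ v ∈ J, subsystemEntropy q ρ {v} =
        ∑ v, (if v ∈ J then (-1 : ℝ) ^ J.card else 0) * subsystemEntropy q ρ {v} := fun J => by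
      simp [Finset.mul_sum, ite_mul]
    simp_rw [this]
    rw [Finset.sum_comm]
    simp_rw [← Finset.sum_mul, sum_neg_one_pow_card_mem_eq_zero, zero_mul, Finset.sum_const_zero]
  simp only [totalCorrelation, mul_sub, Finset.sum_sub_distrib, hlocal, zero_sub,
    interactionInformation, ← Finset.sum_neg_distrib]
  refine Finset.sum_congr rfl fun J _ => ?_
  rw [zpow_sub_one₀ (by norm_num), zpow_natCast]
  norm_num

theorem mainTheorem1 (K : Type*) [Field K] (n : ℕ) (hn : 2 ≤ n) (d : Fin n → Type*)
    [∀ i, Fintype (d i)] [∀ i, DecidableEq (d i)] (ρ : Matrix (∀ i, d i) (∀ i, d i) ℂ)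
    (hρ : IsDensityOperator ρ) (q : ℝ) (hq : 1 < q) :
    -- `C_q` is monotone, so that its sublevel sets form a filtration by simplicial complexes
    ∃ hC : IsMonotoneFunctional (totalCorrelation q ρ),
      -- the integrals and the series defining the integrated Euler characteristic converge
      (∀ k : ℕ, MeasureTheory.IntegrableOn
        (fun ε : ℝ => (reducedBetti K (totalCorrelation q ρ) hC k ε : ℝ)) (Set.Ioi 0)) ∧
      (∀ ε : ℝ, Summable fun k : ℕ =>
        (-1 : ℝ) ^ k * reducedIntegratedBetti K (totalCorrelation q ρ) hC k ε) ∧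
      -- its value at infinity is the interaction information
      Filter.Tendsto (reducedIntegratedEulerChar K (totalCorrelation q ρ) hC) Filter.atTop
        (nhds (interactionInformation q ρ)) := by
  have : Nontrivial (Fin n) := Fin.nontrivial_iff_two_le.2 hn
  refine ⟨isMonotoneFunctional_totalCorrelation hρ hq, integrableOn_reducedBetti _,
    summable_reducedIntegratedBetti _, ?_⟩
  rw [← sum_neg_one_pow_mul_totalCorrelation]
  -- The integrated Euler characteristic is constant from `ε = C_q(𝒜)` on.
  refine tendsto_const_nhds.congr' ?_
  filter_upwards [Filter.eventually_ge_atTop (totalCorrelation q ρ Finset.univ)] with ε hε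
  exact (reducedIntegratedEulerChar_eq_of_univ_le _ (totalCorrelation_empty hρ)
    (totalCorrelation_singleton q ρ) hε).symm
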